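/- Let $d\ge 2$ and let $\mathbb{T}_d$ be the regular $d$-ary tree: its vertices are the finite words over $\{1,\dots,d\}$, its edges are the pairs $\langle x,x\cdot a\rangle$ with $x$ a word and $a\in\{1,\dots,d\}$, and its root $o$ is the empty word. Let $(U_e)_e$ be i.i.d. random variables, indexed by the edges, with the uniform distribution on $[0,1]$. In constrained-degree percolation with degree bound $3$, all edges are closed at time $0$, and the edge $e=\langle u,v\rangle$ opens at time $U_e$ (and stays open from then on) if and only if, among the other edges at $u$, fewer than $3$ opened before time $U_e$, and likewise at $v$; this rule almost surely determines the configuration. An edge $e$ is open at time $t$ if it has opened and $U_e<t$. Let $\theta(t)$ be the probability that infinitely many vertices are connected to $o$ by paths of edges open at time $t$, and let $t_c(\mathbb{T}_d,(3))=\sup\{t\in[0,1]:\theta(t)=0\}$. Then $t_c(\mathbb{T}_d,(3))<1$. -/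

import Mathlib

namespace ConstrainedDegree

open MeasureTheory

section Model

variable {V : Type*} (G : SimpleGraph V) (κ : V → ℕ)

/-- `f` shares an endpoint with `e` and its clock rings strictly before the clock of `e`. -/
def RingsBefore (U : G.edgeSet → unitInterval) (f e : G.edgeSet) : Prop :=
  U f < U e ∧ ∃ v, v ∈ f.1 ∧ v ∈ e.1

/-- The attempt of the edge `e` to open at time `U e` succeeds: for each endpoint `v` of `e`,
fewer than `κ v` of the edges at `v` have successfully opened strictly before time `U e`.
This is a recursion along `RingsBefore`.  It determines the status of every edge from which no
infinite chain of successively earlier adjacent clocks starts (on a graph of bounded degree,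
these are almost surely all the edges); the remaining edges are declared closed. -/
def Succeeds (U : G.edgeSet → unitInterval) (e : G.edgeSet) : Prop :=
  ∃ h : Acc (RingsBefore G U) e,
    h.rec (motive := fun _ _ => Prop) (fun e _ ih =>
      ∀ v ∈ e.1, {u : V | ∃ (huv : G.Adj v u)
        (hlt : RingsBefore G U ⟨s(v, u), huv⟩ e), ih ⟨s(v, u), huv⟩ hlt}.encard < κ v)

/-- The edge `e` is open at time `t` in the temporal configuration driven by the clocks `U`. -/
def IsOpenAt (U : G.edgeSet → unitInterval) (t : ℝ) (e : G.edgeSet) : Prop :=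
  (U e : ℝ) < t ∧ Succeeds G κ U e

/-- The defining equation of the temporal configuration: `e` is open at time `t` iff `U e < t` and
every endpoint `v` of `e` has fewer than `κ v` neighbours `u` such that the edge `vu` is different
from `e` and open at time `U e`. -/
theorem isOpenAt_iff (U : G.edgeSet → unitInterval) (t : ℝ) (e : G.edgeSet)
    (h : Acc (RingsBefore G U) e) :
    IsOpenAt G κ U t e ↔ (U e : ℝ) < t ∧
      ∀ v ∈ e.1, {u : V | ∃ huv : G.Adj v u, s(v, u) ≠ e.1 ∧
        IsOpenAt G κ U (U e) ⟨s(v, u), huv⟩}.encard < κ v := by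
  have key : Succeeds G κ U e ↔ ∀ v ∈ e.1, {u : V | ∃ (huv : G.Adj v u)
      (_ : RingsBefore G U ⟨s(v, u), huv⟩ e),
        Succeeds G κ U ⟨s(v, u), huv⟩}.encard < κ v := by
    cases h with
    | intro _ hacc =>
      constructor
      · rintro ⟨h₀, h⟩ v hv
        obtain rfl : h₀ = Acc.intro _ hacc := rfl
        refine lt_of_eq_of_lt ?_ (h v hv)
        congr 1
        ext u
        exact ⟨fun ⟨a, b, _, d⟩ => ⟨a, b, d⟩, fun ⟨a, b, d⟩ => ⟨a, b, hacc _ b, d⟩⟩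
      · intro h
        refine ⟨Acc.intro _ hacc, fun v hv => ?_⟩
        refine lt_of_eq_of_lt ?_ (h v hv)
        congr 1
        ext u
        exact ⟨fun ⟨a, b, d⟩ => ⟨a, b, hacc _ b, d⟩, fun ⟨a, b, _, d⟩ => ⟨a, b, d⟩⟩
  unfold IsOpenAt
  rw [key]
  refine and_congr_right fun _ => forall₂_congr fun v hv => ?_
  have hset : {u : V | ∃ (huv : G.Adj v u) (_ : RingsBefore G U ⟨s(v, u), huv⟩ e),
        Succeeds G κ U ⟨s(v, u), huv⟩} =
      {u : V | ∃ huv : G.Adj v u, s(v, u) ≠ e.1 ∧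
        ((U ⟨s(v, u), huv⟩ : ℝ) < U e ∧ Succeeds G κ U ⟨s(v, u), huv⟩)} := by
    ext u
    constructor
    · rintro ⟨a, b, d⟩
      refine ⟨a, fun hne => ?_, b.1, d⟩
      have : (⟨s(v, u), a⟩ : G.edgeSet) = e := Subtype.ext hne
      exact absurd b.1 (by rw [this]; exact lt_irrefl _)
    · rintro ⟨a, _, b, d⟩
      exact ⟨a, ⟨b, v, Sym2.mem_mk_left v u, hv⟩, d⟩
  rw [hset]

/-- The subgraph of `G` formed by the edges that are open at time `t`. -/
def openSubgraph (U : G.edgeSet → unitInterval) (t : ℝ) : SimpleGraph V :=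
  SimpleGraph.fromEdgeSet {e | ∃ he : e ∈ G.edgeSet, IsOpenAt G κ U t ⟨e, he⟩}

/-- The event that infinitely many vertices are connected to `o` by paths of edges open at
time `t`. -/
def percolationEvent (o : V) (t : ℝ) : Set (G.edgeSet → unitInterval) :=
  {U | {v : V | (openSubgraph G κ U t).Reachable o v}.Infinite}

/-- The law of the clocks: i.i.d. uniform on `[0, 1]`, on the product σ-algebra. -/
noncomputable def clockLaw : Measure (G.edgeSet → unitInterval) :=
  Measure.infinitePi fun _ => (volume : Measure unitInterval)

/-- The percolation probability at time `t`. -/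
noncomputable def theta (o : V) (t : ℝ) : ℝ :=
  (clockLaw G).real (percolationEvent G κ o t)

/-- The critical time: the supremum of the times `t ∈ [0, 1]` without percolation. (This set
contains `0`.) -/
noncomputable def criticalTime (o : V) : ℝ :=
  sSup {t : ℝ | t ∈ Set.Icc (0 : ℝ) 1 ∧ theta G κ o t = 0}

end Model

/-- The regular `d`-ary tree: its vertices are the finite words over an alphabet of `d` letters,
its edges join each word `x` to its `d` extensions `x · a`; the root is the empty word. -/
def regularTree (d : ℕ) : SimpleGraph (List (Fin d)) where
  Adj x y := (∃ a, y = x ++ [a]) ∨ (∃ a, x = y ++ [a])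
  symm := ⟨fun _ _ h => h.symm⟩
  loopless := ⟨fun x h => by simp at h⟩

end ConstrainedDegree

/-! Picture the tree growing upwards. Call an edge effective if fewer than three effective edges
above its upper endpoint have earlier clocks; its effective time `effTime` is its clock if it is
effective and `1` otherwise. This depends only on the clocks of the edge and of the subtree above
it, so the effective times of siblings are i.i.d. An edge is closed before its own clock rings, so
this recursion decides correctly whether its upper endpoint then has room
(`NoDescent.card_openAbove_lt_iff`). The first two effective edges above any vertex really open: the
edge below and one earlier sibling fill at most two of the three places. It therefore suffices that
these pairs, at times before `t`, contain paths to every level (`NoDescent.mem_percolationEvent`).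

These pairs do not form a Galton-Watson tree. Write `N_r` for the number of effective times before
`r` above a vertex: effective time `s` of the edge below conditions the vertex on `N_s < 3`.
Induction on the level shows that, given an effective time before `t`, failure to reach level `k`
has conditional probability at most 1/2. Given the effective times of the children, their subtrees
fail independently (`lintegral_prod_selected_le`), so failure at the next level costs at most
`E[1{N_s < 3} 2^(-min(2, N_t))]`. This exceeds `P(N_s < 3)/2` by at most `P(N_t = 0)/2 - P(N_t =
2)/4` (`prod_opens_add_le`), a bound free of `s`, and the bound is nonpositive at `t = d/(d+1)`
(`countBelow_eq_zero_le`). So `t_c ≤ d/(d+1)`. -/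

namespace ConstrainedDegree

open MeasureTheory

/-! ### Ranks in a finite family, ties allowed. -/

section Combinatorics

variable {α β : Type*} [LinearOrder β]

/-- At least `min k #F` elements of a finite set `F` have fewer than `k` elements of `F` strictly
below them, even if ties are present. -/
theorem min_le_card_filter_card_lt (F : Finset α) (u : α → β) (k : ℕ) :
    min k F.card ≤ (F.filter fun a => (F.filter fun b => u b < u a).card < k).card := by
  classical
  by_cases h : ∃ a ∈ F, k ≤ (F.filter fun b => u b < u a).card
  -- Take the smallest value of rank at least `k`: everything strictly below it has rank less than
  -- `k`, and there are at least `k` such elements.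
  · obtain ⟨a, ha, hmin⟩ := Finset.exists_min_image
      (F.filter fun a => k ≤ (F.filter fun b => u b < u a).card) u
      (by obtain ⟨a, ha, h⟩ := h; exact ⟨a, by simp [ha, h]⟩)
    rw [Finset.mem_filter] at ha
    refine (min_le_left _ _).trans (ha.2.trans (Finset.card_le_card fun b hb => ?_))
    rw [Finset.mem_filter] at hb ⊢
    refine ⟨hb.1, ?_⟩
    by_contra hk
    exact absurd hb.2 (not_lt.2 (hmin b (by simp [hb.1]; omega)))
  · push Not at h
    rw [Finset.filter_true_of_mem h]
    exact min_le_right _ _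

end Combinatorics

/-! ### Conditional independence in a finite product. -/

section Product

open scoped ENNReal

variable {ι Ω A : Type*} [Fintype ι] [MeasurableSpace Ω] [MeasurableSpace A]

/-- The hypothesis is an inequality between two measures on `A`, the laws of `X` on `S` and on the
whole space, restricted to `g`. It therefore extends from sets to functions vanishing off `g`,
without conditional expectations. -/
theorem lintegral_mul_indicator_le {μ : Measure Ω} [SFinite μ] {X : Ω → A} (hX : Measurable X)
    {S : Set Ω} (hS : MeasurableSet S) {g : Set A} (hg : MeasurableSet g) {c : ℝ≥0∞}
    (h : ∀ B, MeasurableSet B → B ⊆ g → μ (X ⁻¹' B ∩ S) ≤ c * μ (X ⁻¹' B))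
    {f : A → ℝ≥0∞} (hf : Measurable f) (hfg : ∀ x ∉ g, f x = 0) :
    ∫⁻ ω, f (X ω) * S.indicator 1 ω ∂μ ≤ ∫⁻ ω, f (X ω) * c ∂μ := by
  have h1 : ((μ.restrict S).map X).restrict g ≤ c • (μ.map X).restrict g := by
    refine Measure.le_iff.2 fun B hB => ?_
    rw [Measure.restrict_apply hB, Measure.map_apply hX (hB.inter hg),
      Measure.restrict_apply (hX (hB.inter hg)), Measure.smul_apply, Measure.restrict_apply hB,
      Measure.map_apply hX (hB.inter hg)]
    exact h _ (hB.inter hg) Set.inter_subset_right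
  have h2 : ∀ ν : Measure A, ∫⁻ x, f x ∂ν = ∫⁻ x, f x ∂(ν.restrict g) := fun ν => by
    rw [← lintegral_indicator hg]
    congr 1; ext x
    by_cases hx : x ∈ g
    · simp [hx]
    · simp [hx, hfg x hx]
  calc ∫⁻ ω, f (X ω) * S.indicator 1 ω ∂μ = ∫⁻ ω in S, f (X ω) ∂μ := by
        rw [← lintegral_indicator hS]
        congr 1; ext x
        by_cases hx : x ∈ S <;> simp [hx]
    _ = ∫⁻ x, f x ∂(((μ.restrict S).map X).restrict g) := by
        rw [← h2, lintegral_map hf hX]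
    _ ≤ ∫⁻ x, f x ∂(c • (μ.map X).restrict g) := lintegral_mono' h1 le_rfl
    _ = c * ∫⁻ x, f x ∂(μ.map X) := by rw [lintegral_smul_measure, ← h2, smul_eq_mul]
    _ = ∫⁻ ω, f (X ω) * c ∂μ := by
        rw [lintegral_map hf hX,
          ← lintegral_const_mul _ (show Measurable fun ω => f (X ω) from hf.comp hX)]
        simp only [mul_comm]

open Classical in
/-- Let `μ` be a measure under which, within `g`, the event `S` has conditional probability at most
`c` given `X`. For independent copies of `(X, S)`, selecting coordinates with values in `g` through
the values of `X` only, the probability that `S` occurs at all the selected coordinates is at most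
the expectation of `c` to the number of selected coordinates. -/
theorem lintegral_prod_selected_le (μ : Measure Ω) [SigmaFinite μ] {X : Ω → A} (hX : Measurable X)
    {S : Set Ω} (hS : MeasurableSet S) {g : Set A} (hg : MeasurableSet g) {c : ℝ≥0∞}
    (h : ∀ B, MeasurableSet B → B ⊆ g → μ (X ⁻¹' B ∩ S) ≤ c * μ (X ⁻¹' B))
    {f : (ι → A) → ℝ≥0∞} (hf : Measurable f) {O : ι → Set (ι → A)}
    (hO : ∀ a, MeasurableSet (O a)) (hOg : ∀ a, ∀ x ∈ O a, x a ∈ g) :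
    ∫⁻ η, f (fun b => X (η b)) *
        ∏ a, (if (fun b => X (η b)) ∈ O a then S.indicator 1 (η a) else 1)
          ∂(Measure.pi fun _ : ι => μ) ≤
      ∫⁻ η, f (fun b => X (η b)) *
        ∏ a, (if (fun b => X (η b)) ∈ O a then c else 1) ∂(Measure.pi fun _ : ι => μ) := by
  -- `Ψ T` interpolates between the two integrands: the indicator is already replaced by `c` at the
  -- coordinates in `T`. Coordinates are exchanged one at a time, with the others frozen.
  let Ψ : Finset ι → (ι → A) → (ι → Ω) → ℝ≥0∞ := fun T x η =>
    f x * ∏ a, (if x ∈ O a then (if a ∈ T then c else S.indicator 1 (η a)) else 1)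
  let XX : (ι → Ω) → (ι → A) := fun η b => X (η b)
  have hXX : Measurable XX := measurable_pi_lambda _ fun b => hX.comp (measurable_pi_apply b)
  have hS1 : Measurable (S.indicator (1 : Ω → ℝ≥0∞)) := measurable_one.indicator hS
  have hm : ∀ T, Measurable fun η => Ψ T (XX η) η := fun T => by
    refine (hf.comp hXX).mul (Finset.measurable_prod _ fun a _ => ?_)
    refine Measurable.ite (hXX (hO a)) ?_ measurable_const
    split_ifs
    · exact measurable_const
    · exact hS1.comp (measurable_pi_apply a)
  have key : ∀ T, ∫⁻ η, Ψ ∅ (XX η) η ∂(Measure.pi fun _ : ι => μ) ≤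
      ∫⁻ η, Ψ T (XX η) η ∂(Measure.pi fun _ : ι => μ) := by
    intro T
    induction T using Finset.induction_on with
    | empty => exact le_rfl
    | insert a T ha ih =>
      refine ih.trans (lintegral_le_of_lmarginal_le {a} (hm _) (hm _) fun η => ?_)
      rw [lmarginal_singleton, lmarginal_singleton]
      have hup : ∀ ω, XX (Function.update η a ω) = Function.update (XX η) a (X ω) := fun ω => by
        ext b
        by_cases hb : b = a
        · subst hb; simp [XX]
        · simp [XX, hb]
      let R : A → ℝ≥0∞ := fun y =>
        f (Function.update (XX η) a y) * ∏ b ∈ Finset.univ.erase a,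
          (if Function.update (XX η) a y ∈ O b then
            (if b ∈ T then c else S.indicator 1 (η b)) else 1)
      have hupd : Measurable fun y => Function.update (XX η) a y := measurable_update _
      have hR : Measurable R := by
        refine (hf.comp hupd).mul (Finset.measurable_prod _ fun b _ => ?_)
        exact Measurable.ite (hupd (hO b)) measurable_const measurable_const
      have hsplit : ∀ (T' : Finset ι), (∀ b ≠ a, b ∈ T' ↔ b ∈ T) → ∀ ω,
          Ψ T' (XX (Function.update η a ω)) (Function.update η a ω) = R (X ω) *
            (if Function.update (XX η) a (X ω) ∈ O a then
              (if a ∈ T' then c else S.indicator 1 ω) else 1) := fun T' hT' ω => by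
        simp only [Ψ, R, hup]
        rw [← Finset.mul_prod_erase _ _ (Finset.mem_univ a), Function.update_self, mul_assoc]
        congr 1
        rw [mul_comm]
        congr 1
        refine Finset.prod_congr rfl fun b hb => ?_
        have hb' := Finset.ne_of_mem_erase hb
        simp only [hT' b hb', Function.update_of_ne hb']
      simp only [hsplit T (fun _ _ => Iff.rfl), hsplit (insert a T) (fun b hb => by simp [hb]),
        if_neg ha, if_pos (Finset.mem_insert_self a T)]
      -- `Q` holds the values of coordinate `a` for which `a` is selected. Off `Q` the integrands
      -- agree; on `Q ⊆ g` the one-coordinate bound applies.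
      set Q : Set A := {y | Function.update (XX η) a y ∈ O a} with hQdef
      have hQ : MeasurableSet Q := hupd (hO a)
      have e1 : ∀ (ω : Ω) (k : ℝ≥0∞), R (X ω) *
          (if Function.update (XX η) a (X ω) ∈ O a then k else 1) =
          Qᶜ.indicator R (X ω) + Q.indicator R (X ω) * k := fun ω k => by
        by_cases hq : X ω ∈ Q
        · have hq' : Function.update (XX η) a (X ω) ∈ O a := hq
          simp [hq, hq']
        · have hq' : Function.update (XX η) a (X ω) ∉ O a := hq
          simp [hq, hq']
      simp only [e1]
      have hcompl : Measurable fun ω => Qᶜ.indicator R (X ω) := (hR.indicator hQ.compl).comp hX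
      rw [lintegral_add_left hcompl, lintegral_add_left hcompl]
      refine add_le_add le_rfl ?_
      refine lintegral_mul_indicator_le hX hS hg h (hR.indicator hQ) fun x hx => ?_
      refine Set.indicator_of_notMem (fun hxQ => hx ?_) _
      simpa using hOg a _ hxQ
  simpa [Ψ, XX] using key Finset.univ

end Product

/-! ### Absence of infinite decreasing walks. -/

section DescendingChains

open scoped ENNReal

variable {ι : Type*} [DecidableEq ι]

/-- The walks with `n` steps that start at `i` and whose steps go from `j` to an element of
`nb j`. -/
def walks (nb : ι → Finset ι) : ℕ → ι → Finset (List ι)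
  | 0, i => {[i]}
  | n + 1, i => (nb i).biUnion fun j => (walks nb n j).image (List.cons i)

theorem length_of_mem_walks {nb : ι → Finset ι} {n : ℕ} {i : ι} {l : List ι}
    (hl : l ∈ walks nb n i) : l.length = n + 1 := by
  induction n generalizing i l with
  | zero => simp [walks] at hl; simp [hl]
  | succ n ih =>
    simp only [walks, Finset.mem_biUnion, Finset.mem_image] at hl
    obtain ⟨j, _, l', hl', rfl⟩ := hl
    simp [ih hl']

theorem card_walks_le {nb : ι → Finset ι} {D : ℕ} (hD : ∀ i, (nb i).card ≤ D) (n : ℕ) (i : ι) :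
    (walks nb n i).card ≤ D ^ n := by
  induction n generalizing i with
  | zero => simp [walks]
  | succ n ih =>
    rw [walks, pow_succ']
    refine Finset.card_biUnion_le.trans ((Finset.sum_le_card_nsmul _ _ (D ^ n) fun j _ =>
      Finset.card_image_le.trans (ih j)).trans ?_)
    rw [smul_eq_mul]
    exact Nat.mul_le_mul_right _ (hD i)

theorem map_range_mem_walks {nb : ι → Finset ι} (n : ℕ) {f : ℕ → ι}
    (hf : ∀ m, f (m + 1) ∈ nb (f m)) : (List.range (n + 1)).map f ∈ walks nb n (f 0) := by
  induction n generalizing f with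
  | zero => simp [walks]
  | succ n ih =>
    rw [List.range_succ_eq_map, walks, Finset.mem_biUnion]
    refine ⟨f 1, hf 0, Finset.mem_image.2 ⟨_, ih (f := fun m => f (m + 1)) fun m => hf (m + 1), ?_⟩⟩
    simp [Function.comp_def]

/-- The `j`-th of `K` intervals of equal length that partition `[0, 1)`. -/
def gridCell (K j : ℕ) : Set unitInterval := {u | ⌊(K : ℝ) * u⌋₊ = j}

theorem measurableSet_gridCell (K j : ℕ) : MeasurableSet (gridCell K j) := by
  have : Measurable fun u : unitInterval => ⌊(K : ℝ) * u⌋₊ :=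
    Nat.measurable_floor.comp (measurable_const.mul measurable_subtype_coe)
  exact this (measurableSet_singleton j)

theorem volume_gridCell_le {K : ℕ} (hK : 0 < K) (j : ℕ) :
    volume (gridCell K j) ≤ (K : ℝ≥0∞)⁻¹ := by
  have hK' : (0 : ℝ) < K := by exact_mod_cast hK
  rw [unitInterval.volume_apply]
  refine (measure_mono (t := Set.Ico ((j : ℝ) / K) ((j + 1) / K)) ?_).trans ?_
  · rintro _ ⟨u, hu, rfl⟩
    have h := (Nat.floor_eq_iff (mul_nonneg hK'.le u.2.1)).1 hu
    constructor
    · rw [div_le_iff₀ hK']; linarith [h.1]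
    · rw [lt_div_iff₀ hK']; linarith [h.2]
  · rw [Real.volume_Ico, ← sub_div, add_sub_cancel_left, one_div,
      ENNReal.ofReal_inv_of_pos hK', ENNReal.ofReal_natCast]

/-- In a graph of bounded degree with i.i.d. uniform clocks, almost surely there is no infinite
walk along which the clocks decrease. -/
theorem ae_forall_acc [Countable ι] (nb : ι → Finset ι) {D : ℕ} (hD : ∀ i, (nb i).card ≤ D) :
    ∀ᵐ ω ∂(Measure.infinitePi fun _ : ι => (volume : Measure unitInterval)),
      ∀ i, Acc (fun j i => ω j < ω i ∧ j ∈ nb i) i := by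
  set μ := Measure.infinitePi fun _ : ι => (volume : Measure unitInterval)
  -- Along a decreasing walk the index of the grid cell eventually stabilises. There are at most `D
  -- ^ n` walks of `n` steps, each confined to a given cell with probability at most `K⁻¹ ^ n`; any
  -- `K > D` makes the product tend to `0`.
  set K := D + 1 with hKdef
  have hK : 0 < K := Nat.succ_pos D
  let B : ℕ → ι → ℕ → Set (ι → unitInterval) := fun j i n =>
    {ω | ∃ l ∈ walks nb n i, l.Nodup ∧ ∀ x ∈ l, ω x ∈ gridCell K j}
  have hB : ∀ j i n, μ (B j i n) ≤ ((D : ℝ≥0∞) / K) ^ n := fun j i n => by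
    have hsub : B j i n ⊆ ⋃ l ∈ (walks nb n i).filter List.Nodup,
        Set.pi (l.toFinset : Set ι) fun _ => gridCell K j := by
      rintro ω ⟨l, hl, hnd, h⟩
      simp only [Set.mem_iUnion]
      exact ⟨l, Finset.mem_filter.2 ⟨hl, hnd⟩, fun x hx => h x (by simpa using hx)⟩
    calc μ (B j i n) ≤ ∑ l ∈ (walks nb n i).filter List.Nodup,
          μ (Set.pi (l.toFinset : Set ι) fun _ => gridCell K j) :=
          (measure_mono hsub).trans (measure_biUnion_finset_le _ _)
      _ ≤ ∑ l ∈ (walks nb n i).filter List.Nodup, ((K : ℝ≥0∞)⁻¹) ^ n := by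
          refine Finset.sum_le_sum fun l hl => ?_
          rw [Finset.mem_filter] at hl
          rw [Measure.infinitePi_pi _ fun _ _ => measurableSet_gridCell K j, Finset.prod_const,
            List.toFinset_card_of_nodup hl.2, length_of_mem_walks hl.1]
          refine (pow_le_pow_left' (volume_gridCell_le hK j) _).trans ?_
          refine pow_le_pow_right_of_le_one' ?_ (Nat.le_succ n)
          exact ENNReal.inv_le_one.2 (by exact_mod_cast hK)
      _ ≤ (D : ℝ≥0∞) ^ n * ((K : ℝ≥0∞)⁻¹) ^ n := by
          rw [Finset.sum_const, nsmul_eq_mul]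
          gcongr
          exact_mod_cast (Finset.card_filter_le _ _).trans (card_walks_le hD n i)
      _ = ((D : ℝ≥0∞) / K) ^ n := by rw [ENNReal.div_eq_inv_mul, mul_comm, mul_pow]
  have hlt : (D : ℝ≥0∞) / K < 1 := by
    rw [ENNReal.div_lt_iff (Or.inl (by exact_mod_cast hK.ne')) (Or.inl (by simp)), one_mul]
    exact_mod_cast Nat.lt_succ_self D
  have hnull : ∀ j i, μ (⋂ n, B j i n) = 0 := fun j i => by
    refine le_antisymm (ge_of_tendsto' (ENNReal.tendsto_pow_atTop_nhds_zero_of_lt_one hlt)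
      fun n => ?_) bot_le
    exact (measure_mono (Set.iInter_subset _ n)).trans (hB j i n)
  have hae : ∀ᵐ ω ∂μ, ∀ j i, ω ∉ ⋂ n, B j i n :=
    ae_all_iff.2 fun j => ae_all_iff.2 fun i => measure_eq_zero_iff_ae_notMem.1 (hnull j i)
  filter_upwards [hae] with ω hω i
  by_contra hacc
  obtain ⟨f, -, hf⟩ := not_acc_iff_exists_descending_chain.1 hacc
  have hanti : StrictAnti fun n => ω (f n) := strictAnti_nat_of_succ_lt fun n => (hf n).1
  have hanti' : Antitone fun n => ⌊(K : ℝ) * ω (f n)⌋₊ := fun m n hmn =>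
    Nat.floor_mono (mul_le_mul_of_nonneg_left (hanti.antitone hmn) (Nat.cast_nonneg K))
  obtain ⟨N, hN⟩ := WellFoundedLT.antitone_chain_condition hanti'
  refine hω ⌊(K : ℝ) * ω (f N)⌋₊ (f N) (Set.mem_iInter.2 fun n => ?_)
  refine ⟨_, map_range_mem_walks n (f := fun m => f (N + m)) fun m => (hf (N + m)).2, ?_, ?_⟩
  · refine List.Nodup.map (fun a b hab => ?_) List.nodup_range
    have := hanti.injective (congrArg ω hab)
    omega
  · intro x hx
    obtain ⟨m, -, rfl⟩ := List.mem_map.1 hx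
    exact (hN (N + m) (Nat.le_add_right N m)).symm

end DescendingChains

/-! ### Counting clocks before a given time. -/

section Count

variable {ι : Type*} [Fintype ι]

/-- The number of entries of `x` strictly below `s`. -/
noncomputable def countBelow (x : ι → unitInterval) (s : unitInterval) : ℕ :=
  (Finset.univ.filter fun a => x a < s).card

theorem countBelow_le_of_imp {x y : ι → unitInterval} {s s' : unitInterval}
    (h : ∀ a, x a < s → y a < s') : countBelow x s ≤ countBelow y s' :=
  Finset.card_le_card fun a ha => by simpa using h a (by simpa using ha)

theorem countBelow_congr {x y : ι → unitInterval} {s s' : unitInterval}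
    (h : ∀ a, x a < s ↔ y a < s') : countBelow x s = countBelow y s' :=
  le_antisymm (countBelow_le_of_imp fun a => (h a).1) (countBelow_le_of_imp fun a => (h a).2)

theorem measurable_countBelow {α : Type*} [MeasurableSpace α] {X : α → ι → unitInterval}
    {s : α → unitInterval} (hX : Measurable X) (hs : Measurable s) :
    Measurable fun ω => countBelow (X ω) (s ω) := by
  simp only [countBelow, Finset.card_filter]
  refine Finset.measurable_sum _ fun a _ => ?_
  exact Measurable.ite (measurableSet_lt ((measurable_pi_apply a).comp hX) hs)
    measurable_const measurable_const

end Count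

/-- A family of clocks on the words over `d` letters: on a nonempty word, the clock of the edge
to its parent; the value at the empty word plays the role of the clock of an additional edge
above the root. -/
abbrev Clocks (d : ℕ) := List (Fin d) → unitInterval

/-- The law of i.i.d. uniform clocks on the words. -/
noncomputable def wordLaw (d : ℕ) : Measure (Clocks d) :=
  Measure.infinitePi fun _ => (volume : Measure unitInterval)

/-! ### Effective times on the tree of words. -/

section Words

variable {d : ℕ}

instance : IsProbabilityMeasure (wordLaw d) := by unfold wordLaw; infer_instance

/-- The clocks in the subtree above the letter `a`. -/
def kid (a : Fin d) (ω : Clocks d) : Clocks d := fun w => ω (a :: w)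

/-- The clocks in the subtree above the word `x`. -/
def shift (x : List (Fin d)) (ω : Clocks d) : Clocks d := fun w => ω (x ++ w)

@[simp] theorem kid_nil (a : Fin d) (ω : Clocks d) : kid a ω [] = ω [a] := rfl

@[simp] theorem shift_apply_nil (x : List (Fin d)) (ω : Clocks d) : shift x ω [] = ω x := by
  simp [shift]

@[simp] theorem kid_shift (a : Fin d) (x : List (Fin d)) (ω : Clocks d) :
    kid a (shift x ω) = shift (x ++ [a]) ω := by
  ext w; simp [kid, shift]

theorem measurable_kid (a : Fin d) : Measurable (kid a : Clocks d → Clocks d) :=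
  measurable_pi_lambda _ fun w => measurable_pi_apply (a :: w)

theorem measurable_root_kids :
    Measurable fun ω : Clocks d => (ω [], fun a => kid a ω) :=
  (measurable_pi_apply _).prodMk (measurable_pi_lambda _ fun a => measurable_kid a)

open Classical in
/-- The clock at the root if, seen from above, the edge above the root finds a free place at the
root when its clock rings, and `1` otherwise, where the recursion is cut off at depth `n`. -/
noncomputable def approxTime : ℕ → Clocks d → unitInterval
  | 0, ω => ω []
  | n + 1, ω => if countBelow (fun a => approxTime n (kid a ω)) (ω []) < 3 then ω [] else 1

open Classical in
/-- The clock at the root if, seen from above, the edge above the root finds a free place at the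
root when its clock rings, and `1` otherwise. -/
noncomputable def effTime (ω : Clocks d) : unitInterval :=
  if ∀ᶠ n in Filter.atTop, approxTime n ω = ω [] then ω [] else 1

theorem measurable_approxTime (n : ℕ) : Measurable (approxTime n : Clocks d → unitInterval) := by
  induction n with
  | zero => exact measurable_pi_apply _
  | succ n ih =>
    refine Measurable.ite ?_ (measurable_pi_apply _) measurable_const
    exact measurable_countBelow (measurable_pi_lambda _ fun a => ih.comp (measurable_kid a))
      (measurable_pi_apply _) measurableSet_Iio

/-- This is the purpose of the cut-off recursion: each `approxTime n` is visibly measurable, and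
`effTime` is built from countably many of them. -/
theorem measurable_effTime : Measurable (effTime : Clocks d → unitInterval) := by
  refine Measurable.ite ?_ (measurable_pi_apply _) measurable_const
  simp only [Filter.eventually_atTop, Set.ofPred_exists, Set.ofPred_forall]
  exact MeasurableSet.iUnion fun N => MeasurableSet.iInter fun n => MeasurableSet.iInter fun _ =>
    measurableSet_eq_fun (measurable_approxTime n) (measurable_pi_apply _)

theorem le_approxTime (n : ℕ) (ω : Clocks d) : ω [] ≤ approxTime n ω := by
  cases n with
  | zero => exact le_rfl
  | succ n =>
    rw [approxTime]
    split_ifs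
    · exact le_rfl
    · exact unitInterval.le_one'

theorem le_effTime (ω : Clocks d) : ω [] ≤ effTime ω := by
  rw [effTime]
  split_ifs
  · exact le_rfl
  · exact unitInterval.le_one'

/-- The tree of clocks `ω'` sits directly above `ω` and its root has an earlier clock. -/
def EarlierKid (ω' ω : Clocks d) : Prop := ∃ a, ω' = kid a ω ∧ ω' [] < ω []

theorem approxTime_eq_or (n : ℕ) (ω : Clocks d) : approxTime n ω = ω [] ∨ approxTime n ω = 1 := by
  cases n with
  | zero => exact Or.inl rfl
  | succ n =>
    rw [approxTime]
    split_ifs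
    · exact Or.inl rfl
    · exact Or.inr rfl

/-- Only kids with clocks before that of the root can be counted, since `approxTime` never precedes
the clock. By well-founded induction their finitely many values stabilise, and so does the value at
the root. -/
theorem eventually_approxTime_eq {ω : Clocks d} (h : Acc EarlierKid ω) :
    ∀ᶠ n in Filter.atTop, approxTime n ω = effTime ω := by
  have key : ∃ c, ∀ᶠ n in Filter.atTop, approxTime n ω = c := by
    induction h with
    | intro ω _ ih =>
      have h1 : ∀ a, ∃ P : Prop, ∀ᶠ n in Filter.atTop, approxTime n (kid a ω) < ω [] ↔ P := by
        intro a
        by_cases ha : kid a ω [] < ω []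
        · obtain ⟨c, hc⟩ := ih _ ⟨a, rfl, ha⟩
          exact ⟨c < ω [], hc.mono fun n hn => by rw [hn]⟩
        · exact ⟨False, Filter.Eventually.of_forall fun n =>
            iff_of_false (fun hn => ha ((le_approxTime n _).trans_lt hn)) id⟩
      choose P hP using h1
      obtain ⟨N, hN⟩ := Filter.eventually_atTop.1 (Filter.eventually_all.2 hP)
      refine ⟨approxTime (N + 1) ω, Filter.eventually_atTop.2 ⟨N + 1, fun n hn => ?_⟩⟩
      obtain ⟨m, rfl⟩ : ∃ m, n = m + 1 := ⟨n - 1, by omega⟩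
      have : countBelow (fun a => approxTime m (kid a ω)) (ω []) =
          countBelow (fun a => approxTime N (kid a ω)) (ω []) :=
        countBelow_congr fun a => (hN m (by omega) a).trans (hN N le_rfl a).symm
      rw [approxTime, approxTime, this]
  obtain ⟨c, hc⟩ := key
  by_cases h1 : ∀ᶠ n in Filter.atTop, approxTime n ω = ω []
  · simp [effTime, h1]
  · rw [effTime, if_neg h1]
    have hc1 : c ≠ ω [] := fun e => h1 (e ▸ hc)
    refine hc.mono fun n hn => (approxTime_eq_or n ω).resolve_left (hn ▸ hc1)

open Classical in
theorem effTime_eq {ω : Clocks d} (h : Acc EarlierKid ω) :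
    effTime ω =
      if countBelow (fun a => effTime (kid a ω)) (ω []) < 3 then ω [] else 1 := by
  have h1 : ∀ a, ∀ᶠ n in Filter.atTop,
      (approxTime n (kid a ω) < ω [] ↔ effTime (kid a ω) < ω []) := by
    intro a
    by_cases ha : kid a ω [] < ω []
    · exact (eventually_approxTime_eq (h.inv ⟨a, rfl, ha⟩)).mono fun n hn => by rw [hn]
    · exact Filter.Eventually.of_forall fun n => iff_of_false
        (fun hn => ha ((le_approxTime n _).trans_lt hn)) fun hn => ha ((le_effTime _).trans_lt hn)
  obtain ⟨N, hN⟩ := Filter.eventually_atTop.1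
    ((Filter.eventually_all.2 h1).and ((Filter.tendsto_add_atTop_nat 1).eventually
      (eventually_approxTime_eq h)))
  obtain ⟨hN1, hN2⟩ := hN N le_rfl
  rw [← hN2, approxTime, countBelow_congr hN1]

/-- The letter `a` is among the first two of those with effective opening times before `t`. -/
def Opens {ι : Type*} [Fintype ι] (t : unitInterval) (x : ι → unitInterval) (a : ι) : Prop :=
  x a < t ∧ countBelow x (x a) < 2

/-- There is a path to level `k` each of whose edges is one of the first two to open above its
lower endpoint, at a time before `t`. -/
def Survives (t : unitInterval) : ℕ → Clocks d → Prop
  | 0, _ => True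
  | k + 1, ω => ∃ a, Opens t (fun b => effTime (kid b ω)) a ∧ Survives t k (kid a ω)

theorem measurableSet_opens {ι : Type*} [Fintype ι] (t : unitInterval) (a : ι) :
    MeasurableSet {x : ι → unitInterval | Opens t x a} :=
  (measurableSet_lt (measurable_pi_apply a) measurable_const).inter
    (measurable_countBelow measurable_id (measurable_pi_apply a) measurableSet_Iio)

theorem measurable_effTime_kid :
    Measurable fun (ω : Clocks d) b => effTime (kid b ω) :=
  measurable_pi_lambda _ fun b => measurable_effTime.comp (measurable_kid b)

theorem measurableSet_survives (t : unitInterval) (k : ℕ) :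
    MeasurableSet {ω : Clocks d | Survives t k ω} := by
  induction k with
  | zero => exact MeasurableSet.univ
  | succ k ih =>
    simp only [Survives, Set.ofPred_exists]
    exact MeasurableSet.iUnion fun a =>
      (measurable_effTime_kid (measurableSet_opens t a)).inter (measurable_kid a ih)

theorem Survives.of_succ {t : unitInterval} {k : ℕ} {ω : Clocks d} (h : Survives t (k + 1) ω) :
    Survives t k ω := by
  induction k generalizing ω with
  | zero => trivial
  | succ k ih =>
    obtain ⟨a, ha, h⟩ := h
    exact ⟨a, ha, ih h⟩

/-- The clock at the root and the clocks in the subtrees above the letters are independent. -/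
theorem map_wordLaw_root_kids (d : ℕ) :
    (wordLaw d).map (fun ω => (ω [], fun a => kid a ω)) =
      (volume : Measure unitInterval).prod (Measure.pi fun _ : Fin d => wordLaw d) := by
  classical
  let c : Fin d × List (Fin d) → List (Fin d) := fun p => p.1 :: p.2
  have hc : Function.Injective c := fun p q h => by
    simp only [c, List.cons.injEq] at h
    exact Prod.ext h.1 h.2
  set ν := Measure.infinitePi fun _ : Fin d × List (Fin d) => (volume : Measure unitInterval)
    with hν
  let J : unitInterval × (Fin d × List (Fin d) → unitInterval) → Clocks d := fun p l =>
    match l with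
    | [] => p.1
    | a :: w => p.2 (a, w)
  have hJ : Measurable J := measurable_pi_lambda _ fun l => by
    cases l with
    | nil => exact measurable_fst
    | cons a w => exact (measurable_pi_apply (a, w)).comp measurable_snd
  -- `J` reassembles the clocks from the root clock and those of the words `a :: w`; a product
  -- measure is determined by its values on finite boxes.
  have h1 : ((volume : Measure unitInterval).prod ν).map J = wordLaw d := by
    refine Measure.eq_infinitePi _ fun s t ht => ?_
    have hpre : J ⁻¹' (Set.pi s t) = (if [] ∈ s then t [] else Set.univ) ×ˢ
        Set.pi ((s.preimage c hc.injOn : Finset _) : Set _) (fun p => t (c p)) := by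
      ext ⟨u, η⟩
      simp only [Set.mem_preimage, Set.mem_pi, Finset.mem_coe, Set.mem_prod, Finset.mem_preimage]
      constructor
      · intro h
        refine ⟨?_, fun p hp => h _ hp⟩
        split_ifs with h0
        · exact h _ h0
        · trivial
      · rintro ⟨h0, h⟩ l hl
        cases l with
        | nil => simpa [hl] using h0
        | cons a w => exact h (a, w) hl
    rw [Measure.map_apply hJ (MeasurableSet.pi s.countable_toSet fun i _ => ht i), hpre,
      Measure.prod_prod, hν, Measure.infinitePi_pi _ fun p _ => ht _,
      Finset.prod_preimage' c s hc.injOn (fun l => volume (t l))]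
    have hs : s.filter (fun l => l ∈ Set.range c) = s.erase [] := by
      ext l
      cases l with
      | nil => simp [c]
      | cons a w => simp [c]
    rw [hs]
    split_ifs with h0
    · exact Finset.mul_prod_erase s (fun l => volume (t l)) h0
    · rw [measure_univ, one_mul, Finset.erase_eq_of_notMem h0]
  have h3 : ν.map (MeasurableEquiv.curry (Fin d) (List (Fin d)) unitInterval) =
      Measure.pi fun _ : Fin d => wordLaw d := by
    rw [hν, Measure.infinitePi_map_curry (fun _ _ => (volume : Measure unitInterval)),
      Measure.infinitePi_eq_pi]
    rfl
  have h4 := Measure.map_prod_map (volume : Measure unitInterval) ν measurable_id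
    (MeasurableEquiv.curry (Fin d) (List (Fin d)) unitInterval).measurable
  rw [Measure.map_id] at h4
  rw [← h3, ← h1, Measure.map_map measurable_root_kids hJ, h4]
  rfl

end Words

/-! ### From effective times to open paths. -/

section Tree

variable {d : ℕ}

theorem regularTree_adj_append (x : List (Fin d)) (a : Fin d) :
    (regularTree d).Adj x (x ++ [a]) := Or.inl ⟨a, rfl⟩

/-- The edge between the word `x` and its extension by the letter `a`. -/
def edge (x : List (Fin d)) (a : Fin d) : (regularTree d).edgeSet :=
  ⟨s(x, x ++ [a]), regularTree_adj_append x a⟩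

theorem exists_eq_edge (e : (regularTree d).edgeSet) : ∃ x a, e = edge x a := by
  obtain ⟨e, he⟩ := e
  induction e using Sym2.ind with
  | _ x y =>
    rcases he with ⟨a, h⟩ | ⟨a, h⟩
    · exact ⟨x, a, Subtype.ext (congrArg (fun z => s(x, z)) h)⟩
    · exact ⟨y, a, Subtype.ext ((congrArg (fun z => s(z, y)) h).trans Sym2.eq_swap)⟩

theorem edge_eq_edge_iff {x y : List (Fin d)} {a b : Fin d} :
    edge x a = edge y b ↔ x ++ [a] = y ++ [b] := by
  constructor
  · intro h
    have h' : s(x, x ++ [a]) = s(y, y ++ [b]) := congrArg Subtype.val h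
    rcases Sym2.eq_iff.1 h' with ⟨_, h⟩ | ⟨h1, h2⟩
    · exact h
    · have e1 := congrArg List.length h1
      have e2 := congrArg List.length h2
      simp at e1 e2
      omega
  · intro h
    obtain ⟨rfl, h⟩ := List.append_inj' h rfl
    obtain rfl : a = b := by simpa using h
    rfl

/-- The longer endpoint of an edge. -/
noncomputable def top (e : (regularTree d).edgeSet) : List (Fin d) :=
  (exists_eq_edge e).choose ++ [(exists_eq_edge e).choose_spec.choose]

@[simp] theorem top_edge (x : List (Fin d)) (a : Fin d) : top (edge x a) = x ++ [a] :=
  (edge_eq_edge_iff.1 (exists_eq_edge (edge x a)).choose_spec.choose_spec).symm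

theorem top_injective : Function.Injective (top : (regularTree d).edgeSet → List (Fin d)) := by
  intro e f h
  obtain ⟨x, a, rfl⟩ := exists_eq_edge e
  obtain ⟨y, b, rfl⟩ := exists_eq_edge f
  rw [top_edge, top_edge] at h
  exact edge_eq_edge_iff.2 h

/-- The clocks on the edges of the tree read off from clocks on the words. -/
noncomputable def edgeClocks (ω : Clocks d) : (regularTree d).edgeSet → unitInterval :=
  fun e => ω (top e)

theorem measurable_edgeClocks :
    Measurable (edgeClocks : Clocks d → (regularTree d).edgeSet → unitInterval) :=
  measurable_pi_lambda _ fun e => measurable_pi_apply (top e)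

/-- Reading i.i.d. clocks along an injection gives i.i.d. clocks. The clock at the empty word is
never read, as `top` is always nonempty. -/
theorem map_edgeClocks : (wordLaw d).map edgeClocks = clockLaw (regularTree d) :=
  Measure.map_infinitePi_infinitePi_of_inj
    (P := fun _ : List (Fin d) => (volume : Measure unitInterval)) top_injective

/-- A finite set containing the longer endpoints of the edges adjacent to the edge with longer
endpoint `x`. -/
def nearby (x : List (Fin d)) : Finset (List (Fin d)) :=
  insert x.dropLast ((Finset.univ.image fun a => x ++ [a]) ∪
    Finset.univ.image fun a => x.dropLast ++ [a])

theorem card_nearby_le (x : List (Fin d)) : (nearby x).card ≤ 2 * d + 1 := by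
  refine (Finset.card_insert_le _ _).trans (Nat.succ_le_succ ((Finset.card_union_le _ _).trans ?_))
  have h : ∀ f : Fin d → List (Fin d), (Finset.univ.image f).card ≤ d := fun f =>
    Finset.card_image_le.trans (by simp)
  linarith [h fun a => x ++ [a], h fun a => x.dropLast ++ [a]]

theorem append_mem_nearby (x : List (Fin d)) (a : Fin d) : x ++ [a] ∈ nearby x := by
  simp [nearby]

theorem RingsBefore.top {ω : Clocks d} {f e : (regularTree d).edgeSet}
    (h : RingsBefore (regularTree d) (edgeClocks ω) f e) :
    ω (top f) < ω (top e) ∧ ConstrainedDegree.top f ∈ nearby (ConstrainedDegree.top e) := by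
  obtain ⟨hlt, v, hf, he⟩ := h
  refine ⟨hlt, ?_⟩
  obtain ⟨x, a, rfl⟩ := exists_eq_edge e
  obtain ⟨y, b, rfl⟩ := exists_eq_edge f
  simp only [edge, Sym2.mem_iff] at hf he
  rw [top_edge, top_edge]
  simp only [nearby, List.dropLast_concat, Finset.mem_insert, Finset.mem_union, Finset.mem_image,
    Finset.mem_univ, true_and]
  rcases he with rfl | rfl <;> rcases hf with rfl | hf
  · exact Or.inr (Or.inr ⟨b, rfl⟩)
  · exact Or.inl hf.symm
  · exact Or.inr (Or.inl ⟨b, rfl⟩)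
  · exact Or.inr (Or.inr ⟨a, hf⟩)

/-- No infinite walk along adjacent edges has decreasing clocks. -/
def NoDescent (ω : Clocks d) : Prop := ∀ x, Acc (fun y x => ω y < ω x ∧ y ∈ nearby x) x

theorem ae_noDescent (d : ℕ) : ∀ᵐ ω ∂(wordLaw d), NoDescent ω :=
  ae_forall_acc nearby card_nearby_le

variable {ω : Clocks d}

theorem NoDescent.acc_ringsBefore (h : NoDescent ω) (e : (regularTree d).edgeSet) :
    Acc (RingsBefore (regularTree d) (edgeClocks ω)) e :=
  Subrelation.accessible (fun hfe => hfe.top) (InvImage.accessible top (h (top e)))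

theorem NoDescent.acc_earlierKid (h : NoDescent ω) (x : List (Fin d)) :
    Acc EarlierKid (shift x ω) := by
  induction h x with
  | intro x _ ih =>
    refine Acc.intro _ ?_
    rintro _ ⟨a, rfl, ha⟩
    rw [kid_shift] at ha ⊢
    exact ih _ ⟨by simpa using ha, append_mem_nearby x a⟩

/-- The edge between `x` and `x ++ [a]` opens at some time. -/
def EdgeSucceeds (ω : Clocks d) (x : List (Fin d)) (a : Fin d) : Prop :=
  Succeeds (regularTree d) (fun _ => 3) (edgeClocks ω) (edge x a)

/-- The neighbours of `v` joined to it by an open edge, different from `e` and opened before `s`. -/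
def openNeighbours (ω : Clocks d) (e : Sym2 (List (Fin d))) (s : unitInterval)
    (v : List (Fin d)) : Set (List (Fin d)) :=
  {u | ∃ huv : (regularTree d).Adj v u, s(v, u) ≠ e ∧
    IsOpenAt (regularTree d) (fun _ => 3) (edgeClocks ω) s ⟨s(v, u), huv⟩}

theorem NoDescent.edgeSucceeds_iff (h : NoDescent ω) (x : List (Fin d)) (a : Fin d) :
    EdgeSucceeds ω x a ↔
      (openNeighbours ω s(x, x ++ [a]) (ω (x ++ [a])) x).encard < 3 ∧
      (openNeighbours ω s(x, x ++ [a]) (ω (x ++ [a])) (x ++ [a])).encard < 3 := by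
  -- The time `2` exceeds every clock, so being open at that time just means having opened.
  have hiff := isOpenAt_iff (regularTree d) (fun _ => 3) (edgeClocks ω) 2 (edge x a)
    (h.acc_ringsBefore _)
  have hlt : (edgeClocks ω (edge x a) : ℝ) < 2 :=
    (unitInterval.le_one _).trans_lt one_lt_two
  rw [IsOpenAt] at hiff
  simp only [hlt, true_and] at hiff
  rw [EdgeSucceeds, hiff]
  have he : edgeClocks ω (edge x a) = ω (x ++ [a]) := by rw [edgeClocks, top_edge]
  rw [he]
  constructor
  · intro hv
    exact ⟨hv x (Sym2.mem_mk_left _ _), hv _ (Sym2.mem_mk_right _ _)⟩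
  · rintro ⟨h1, h2⟩ v hv
    rcases Sym2.mem_iff.1 hv with rfl | rfl
    · exact h1
    · exact h2

open Classical in
/-- The letters whose edges above `x` open before `s`. -/
noncomputable def openAbove (ω : Clocks d) (x : List (Fin d)) (s : unitInterval) :
    Finset (Fin d) :=
  Finset.univ.filter fun b => ω (x ++ [b]) < s ∧ EdgeSucceeds ω x b

theorem mem_openAbove {x : List (Fin d)} {s : unitInterval} {b : Fin d} :
    b ∈ openAbove ω x s ↔ ω (x ++ [b]) < s ∧ EdgeSucceeds ω x b := by
  simp [openAbove]

theorem isOpenAt_edge_iff {x : List (Fin d)} {s : unitInterval} {b : Fin d} :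
    IsOpenAt (regularTree d) (fun _ => 3) (edgeClocks ω) s (edge x b) ↔
      b ∈ openAbove ω x s := by
  rw [mem_openAbove, IsOpenAt, edgeClocks, top_edge, EdgeSucceeds, Subtype.coe_lt_coe]

theorem append_singleton_injective (x : List (Fin d)) :
    Function.Injective fun b : Fin d => x ++ [b] := fun a b h => by simpa using h

theorem encard_image_openAbove (x : List (Fin d)) (s : unitInterval) :
    ((fun b : Fin d => x ++ [b]) '' (openAbove ω x s : Set (Fin d))).encard =
      (openAbove ω x s).card := by
  rw [(append_singleton_injective x).encard_image, Set.encard_coe_eq_coe_finsetCard]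

theorem encard_openNeighbours_top (x : List (Fin d)) (a : Fin d) (s : unitInterval) :
    (openNeighbours ω s(x, x ++ [a]) s (x ++ [a])).encard = (openAbove ω (x ++ [a]) s).card := by
  rw [← encard_image_openAbove]
  congr 1
  ext u
  constructor
  · rintro ⟨⟨b, rfl⟩ | ⟨b, hb⟩, hne, ho⟩
    · exact ⟨b, isOpenAt_edge_iff.1 ho, rfl⟩
    · obtain ⟨rfl, -⟩ := List.append_inj' hb rfl
      exact absurd Sym2.eq_swap hne
  · rintro ⟨b, hb, rfl⟩
    refine ⟨regularTree_adj_append _ b, fun h => ?_, isOpenAt_edge_iff.2 hb⟩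
    have := edge_eq_edge_iff.1 (Subtype.ext h : edge (x ++ [a]) b = edge x a)
    simp at this

/-- The edge below `x` takes at most one place. At the root there is no such edge, and the junk
value `[].dropLast = []` only enlarges the bound. -/
theorem openNeighbours_subset (x : List (Fin d)) (e : Sym2 (List (Fin d))) (s : unitInterval) :
    openNeighbours ω e s x ⊆
      insert x.dropLast ((fun b : Fin d => x ++ [b]) '' (openAbove ω x s : Set (Fin d))) := by
  rintro u ⟨⟨b, rfl⟩ | ⟨b, rfl⟩, -, ho⟩
  · exact Or.inr ⟨b, isOpenAt_edge_iff.1 ho, rfl⟩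
  · exact Or.inl (by simp)

theorem openNeighbours_subset_of_le {x : List (Fin d)} (e : Sym2 (List (Fin d)))
    {s : unitInterval} (hs : s ≤ ω x) :
    openNeighbours ω e s x ⊆
      (fun b : Fin d => x ++ [b]) '' (openAbove ω x s : Set (Fin d)) := by
  rintro u ⟨⟨b, rfl⟩ | ⟨b, rfl⟩, -, ho⟩
  · exact ⟨b, isOpenAt_edge_iff.1 ho, rfl⟩
  · have hlt := ho.1
    have : (⟨s(u ++ [b], u), Or.inr ⟨b, rfl⟩⟩ : (regularTree d).edgeSet) = edge u b :=
      Subtype.ext Sym2.eq_swap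
    rw [this, edgeClocks, top_edge, Subtype.coe_lt_coe] at hlt
    exact absurd hlt (not_lt.2 hs)

theorem EdgeSucceeds.card_openAbove_lt {x : List (Fin d)} {a : Fin d} (hs : EdgeSucceeds ω x a)
    (h : NoDescent ω) : (openAbove ω (x ++ [a]) (ω (x ++ [a]))).card < 3 := by
  have := ((h.edgeSucceeds_iff x a).1 hs).2
  rw [encard_openNeighbours_top] at this
  exact_mod_cast this

/-- One place at `x` is reserved for the edge below, so the conclusion holds whatever happens
beneath `x`. -/
theorem NoDescent.edgeSucceeds_of_card_lt_two (h : NoDescent ω) {x : List (Fin d)} {a : Fin d}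
    (h1 : (openAbove ω (x ++ [a]) (ω (x ++ [a]))).card < 3)
    (h2 : (openAbove ω x (ω (x ++ [a]))).card < 2) : EdgeSucceeds ω x a := by
  rw [h.edgeSucceeds_iff, encard_openNeighbours_top]
  refine ⟨?_, by exact_mod_cast h1⟩
  refine ((Set.encard_le_encard (openNeighbours_subset x _ _)).trans
    (Set.encard_insert_le _ _)).trans_lt ?_
  rw [encard_image_openAbove]
  exact_mod_cast Nat.succ_lt_succ h2

/-- Until the clock of `x` rings the edge below is closed, so all three places at `x` are available
to the edges above. -/
theorem NoDescent.edgeSucceeds_of_card_lt_three (h : NoDescent ω) {x : List (Fin d)} {a : Fin d}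
    (h1 : (openAbove ω (x ++ [a]) (ω (x ++ [a]))).card < 3)
    (h2 : (openAbove ω x (ω (x ++ [a]))).card < 3) (h3 : ω (x ++ [a]) ≤ ω x) :
    EdgeSucceeds ω x a := by
  rw [h.edgeSucceeds_iff, encard_openNeighbours_top]
  refine ⟨?_, by exact_mod_cast h1⟩
  refine (Set.encard_le_encard (openNeighbours_subset_of_le _ h3)).trans_lt ?_
  rw [encard_image_openAbove]
  exact_mod_cast h2

/-- The effective opening times of the edges above the word `x`. -/
noncomputable def kidTimes (ω : Clocks d) (x : List (Fin d)) : Fin d → unitInterval :=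
  fun b => effTime (shift (x ++ [b]) ω)

open Classical in
theorem NoDescent.effTime_shift (h : NoDescent ω) (x : List (Fin d)) :
    effTime (shift x ω) = if countBelow (kidTimes ω x) (ω x) < 3 then ω x else 1 := by
  have := effTime_eq (h.acc_earlierKid x)
  simp only [kid_shift, shift_apply_nil] at this
  exact this

theorem NoDescent.effTime_shift_lt_iff (h : NoDescent ω) {x : List (Fin d)} {s : unitInterval} :
    effTime (shift x ω) < s ↔ ω x < s ∧ countBelow (kidTimes ω x) (ω x) < 3 := by
  rw [h.effTime_shift]
  split_ifs with hc
  · simp [hc]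
  · simp only [hc, and_false, iff_false, not_lt]
    exact unitInterval.le_one'

theorem NoDescent.effTime_shift_eq (h : NoDescent ω) {x : List (Fin d)}
    (hx : countBelow (kidTimes ω x) (ω x) < 3) : effTime (shift x ω) = ω x := by
  rw [h.effTime_shift, if_pos hx]

/-- The number of edges above `x` that open before the clock of `x` rings reaches the degree bound
if and only if this happens for the edges that find a free place at their longer endpoints. -/
theorem NoDescent.card_openAbove_lt_iff (h : NoDescent ω) (x : List (Fin d)) :
    (openAbove ω x (ω x)).card < 3 ↔ countBelow (kidTimes ω x) (ω x) < 3 := by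
  induction h x with
  | intro x _ ih =>
    replace ih : ∀ b, ω (x ++ [b]) < ω x → ((openAbove ω (x ++ [b]) (ω (x ++ [b]))).card < 3 ↔
        countBelow (kidTimes ω (x ++ [b])) (ω (x ++ [b])) < 3) :=
      fun b hb => ih _ ⟨hb, append_mem_nearby x b⟩
    -- Edges that open are effective, so open edges are never more numerous than effective ones. The
    -- converse can fail, as an effective edge may find its lower endpoint full.
    have hsub : ∀ b, ω (x ++ [b]) < ω x → EdgeSucceeds ω x b →
        kidTimes ω x b = ω (x ++ [b]) := fun b hb hs =>
      h.effTime_shift_eq ((ih b hb).1 (hs.card_openAbove_lt h))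
    constructor
    · intro hlt
      by_contra hge
      rw [not_lt] at hge
      refine absurd hlt (not_lt.2 ?_)
      -- If three effective times precede the clock of `x`, then at least three edges of `F` have
      -- rank below three in `F`, and these really open.
      set F := Finset.univ.filter fun b => kidTimes ω x b < ω x with hF
      have hcard := min_le_card_filter_card_lt F (kidTimes ω x) 3
      rw [min_eq_left (show 3 ≤ F.card from hge)] at hcard
      refine hcard.trans (Finset.card_le_card fun b hb => ?_)
      simp only [hF, Finset.mem_filter, Finset.mem_univ, true_and] at hb
      obtain ⟨hb1, hb2⟩ := hb
      obtain ⟨hb3, hb4⟩ := h.effTime_shift_lt_iff.1 hb1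
      have hb5 : kidTimes ω x b = ω (x ++ [b]) := h.effTime_shift_eq hb4
      refine mem_openAbove.2 ⟨hb3, h.edgeSucceeds_of_card_lt_three ((ih b hb3).2 hb4) ?_ hb3.le⟩
      refine (Finset.card_le_card fun c hc => ?_).trans_lt hb2
      obtain ⟨hc1, hc2⟩ := mem_openAbove.1 hc
      have hc3 := hsub c (hc1.trans hb3) hc2
      simp only [Finset.mem_filter, Finset.mem_univ, true_and, hc3, hb5]
      exact ⟨hc1.trans hb3, hc1⟩
    · refine (Finset.card_le_card fun b hb => ?_).trans_lt
      obtain ⟨hb1, hb2⟩ := mem_openAbove.1 hb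
      simp only [Finset.mem_filter, Finset.mem_univ, true_and, hsub b hb1 hb2]
      exact hb1

theorem EdgeSucceeds.kidTimes_eq {x : List (Fin d)} {a : Fin d} (hs : EdgeSucceeds ω x a)
    (h : NoDescent ω) : kidTimes ω x a = ω (x ++ [a]) :=
  h.effTime_shift_eq ((h.card_openAbove_lt_iff _).1 (hs.card_openAbove_lt h))

theorem NoDescent.edgeSucceeds_of_opens (h : NoDescent ω) {x : List (Fin d)} {a : Fin d}
    {t : unitInterval} (ha : Opens t (kidTimes ω x) a) :
    ω (x ++ [a]) < t ∧ EdgeSucceeds ω x a := by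
  obtain ⟨h1, h2⟩ := ha
  obtain ⟨h3, h4⟩ := h.effTime_shift_lt_iff.1 h1
  refine ⟨h3, h.edgeSucceeds_of_card_lt_two ((h.card_openAbove_lt_iff _).2 h4) ?_⟩
  refine (Finset.card_le_card fun b hb => ?_).trans_lt h2
  obtain ⟨hb1, hb2⟩ := mem_openAbove.1 hb
  have ha : kidTimes ω x a = ω (x ++ [a]) := h.effTime_shift_eq h4
  simpa [hb2.kidTimes_eq h, ha] using hb1

theorem NoDescent.exists_reachable (h : NoDescent ω) {t : unitInterval} {k : ℕ}
    {x : List (Fin d)} (hs : Survives t k (shift x ω)) :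
    ∃ y, y.length = x.length + k ∧
      (openSubgraph (regularTree d) (fun _ => 3) (edgeClocks ω) t).Reachable x y := by
  induction k generalizing x with
  | zero => exact ⟨x, rfl, SimpleGraph.Reachable.refl _⟩
  | succ k ih =>
    obtain ⟨a, ha, hk⟩ := hs
    simp only [kid_shift] at ha hk
    obtain ⟨y, hy, hreach⟩ := ih hk
    refine ⟨y, by simp at hy; omega, SimpleGraph.Reachable.trans (SimpleGraph.Adj.reachable ?_)
      hreach⟩
    rw [openSubgraph, SimpleGraph.fromEdgeSet_adj]
    exact ⟨⟨regularTree_adj_append x a,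
      isOpenAt_edge_iff.2 (mem_openAbove.2 (h.edgeSucceeds_of_opens ha))⟩, by simp⟩

theorem NoDescent.mem_percolationEvent (h : NoDescent ω) {t : unitInterval}
    (hs : ∀ k, Survives t k ω) :
    edgeClocks ω ∈ percolationEvent (regularTree d) (fun _ => 3) [] t := by
  refine Set.Infinite.of_image List.length ?_
  convert Set.infinite_univ (α := ℕ)
  refine Set.eq_univ_of_forall fun k => ?_
  obtain ⟨y, hy, hreach⟩ := h.exists_reachable (x := []) (hs k)
  exact ⟨y, hreach, by simpa using hy⟩

end Tree

/-! ### The rank of one of several i.i.d. clocks. -/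

section Rank

open scoped ENNReal

/-- Among `n` i.i.d. clocks, a given one is among the first three with probability at
least `3 / n`. -/
theorem min_le_card_mul_countBelow_lt {ι : Type*} [Fintype ι] (i : ι) :
    ((min 3 (Fintype.card ι) : ℕ) : ℝ≥0∞) ≤ Fintype.card ι *
      Measure.infinitePi (fun _ : ι => (volume : Measure unitInterval))
        {y | countBelow y (y i) < 3} := by
  classical
  set ν := Measure.infinitePi fun _ : ι => (volume : Measure unitInterval)
  have hE : ∀ j : ι, MeasurableSet {y : ι → unitInterval | countBelow y (y j) < 3} := fun j =>
    measurable_countBelow measurable_id (measurable_pi_apply j) measurableSet_Iio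
  -- By exchangeability all indices have the same chance of a low rank; summing over them gives the
  -- expected number of low ranks, which is bounded below pointwise.
  have hsymm : ∀ j, ν {y | countBelow y (y j) < 3} = ν {y | countBelow y (y i) < 3} := fun j => by
    have hmap : ν.map (fun y k => y (Equiv.swap i j k)) = ν :=
      Measure.map_infinitePi_infinitePi_of_inj (P := fun _ : ι => (volume : Measure unitInterval))
        (Equiv.swap i j).injective
    have hm : Measurable fun (y : ι → unitInterval) k => y (Equiv.swap i j k) :=
      measurable_pi_lambda _ fun k => measurable_pi_apply _
    rw [← hmap, Measure.map_apply hm (hE i), hmap]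
    congr 1
    ext y
    simp only [Set.mem_ofPred_eq, Set.mem_preimage, Equiv.swap_apply_left]
    have : countBelow (fun k => y (Equiv.swap i j k)) (y j) = countBelow y (y j) :=
      Finset.card_bij (fun k _ => Equiv.swap i j k) (fun k hk => by simpa using hk)
        (fun a _ b _ hab => (Equiv.swap i j).injective hab)
        fun b hb => ⟨Equiv.swap i j b, by simpa using hb, by simp⟩
    rw [this]
  calc ((min 3 (Fintype.card ι) : ℕ) : ℝ≥0∞)
      = ∫⁻ _, ((min 3 (Fintype.card ι) : ℕ) : ℝ≥0∞) ∂ν := by simp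
    _ ≤ ∫⁻ y, ∑ j, Set.indicator {y : ι → unitInterval | countBelow y (y j) < 3} 1 y ∂ν := by
        refine lintegral_mono fun y => ?_
        have h := min_le_card_filter_card_lt Finset.univ y 3
        rw [Finset.card_univ] at h
        refine (Nat.cast_le.2 h).trans (le_of_eq ?_)
        rw [Finset.card_filter, Nat.cast_sum]
        refine Finset.sum_congr rfl fun j _ => ?_
        by_cases hj : (Finset.univ.filter fun b => y b < y j).card < 3
        · rw [Set.indicator_of_mem (show y ∈ {y | countBelow y (y j) < 3} from hj), if_pos hj]
          exact Nat.cast_one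
        · rw [Set.indicator_of_notMem (show y ∉ {y | countBelow y (y j) < 3} from hj), if_neg hj]
          exact Nat.cast_zero
    _ = ∑ j, ν {y | countBelow y (y j) < 3} := by
        rw [lintegral_finsetSum _ fun j _ => measurable_one.indicator (hE j)]
        exact Finset.sum_congr rfl fun j _ => lintegral_indicator_one (hE j)
    _ = _ := by simp [hsymm]

end Rank

/-! ### Survival of the two-edge tree and the bound on the critical time. -/

section Survival

open scoped ENNReal

variable {d : ℕ}

theorem ae_effTime_eq (d : ℕ) : ∀ᵐ ω ∂(wordLaw d),
    (countBelow (fun a => effTime (kid a ω)) (ω []) < 3 → effTime ω = ω []) ∧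
    (¬ countBelow (fun a => effTime (kid a ω)) (ω []) < 3 → effTime ω = 1) := by
  filter_upwards [ae_noDescent d] with ω hω
  have h : Acc EarlierKid ω := hω.acc_earlierKid []
  rw [effTime_eq h]
  exact ⟨fun h => if_pos h, fun h => if_neg h⟩

/-- The root clock competes with `d` others, so it is among the first three of `d + 1` with
probability at least `3 / (d + 1)`; `2 ≤ d` makes the minimum with `d + 1` equal to `3`. -/
theorem three_le_mul_countBelow_lt (hd : 2 ≤ d) : (3 : ℝ≥0∞) ≤ (d + 1 : ℕ) * wordLaw d
    {ω | countBelow (fun a : Fin d => ω [a]) (ω []) < 3} := by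
  let v : Option (Fin d) → List (Fin d) := fun i => i.elim [] fun a => [a]
  have hv : Function.Injective v := by
    rintro (_ | a) (_ | b) h <;> simp_all [v]
  have hmap : (wordLaw d).map (fun ω i => ω (v i)) =
      Measure.infinitePi (fun _ : Option (Fin d) => (volume : Measure unitInterval)) :=
    Measure.map_infinitePi_infinitePi_of_inj
      (P := fun _ : List (Fin d) => (volume : Measure unitInterval)) hv
  have hm : Measurable fun (ω : Clocks d) i => ω (v i) :=
    measurable_pi_lambda _ fun i => measurable_pi_apply (v i)
  have h := min_le_card_mul_countBelow_lt (none : Option (Fin d))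
  have hE : MeasurableSet {y : Option (Fin d) → unitInterval | countBelow y (y none) < 3} :=
    measurable_countBelow measurable_id (measurable_pi_apply none) measurableSet_Iio
  rw [← hmap, Measure.map_apply hm hE,
    Fintype.card_option, Fintype.card_fin, min_eq_left (by omega)] at h
  refine le_trans (by norm_num) (h.trans (mul_le_mul_right (measure_mono fun ω hω => ?_) _))
  refine lt_of_le_of_lt (b := countBelow (fun i => ω (v i)) (ω (v none))) ?_ hω
  refine Finset.card_le_card_of_injOn some (fun a ha => ?_) fun a _ b _ hab => by simpa using hab
  exact Finset.mem_filter.2 ⟨Finset.mem_univ _, (Finset.mem_filter.1 ha).2⟩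

/-- The time `d / (d + 1)`. -/
noncomputable def lateTime (d : ℕ) : unitInterval :=
  ⟨(d : ℝ) / (d + 1), by positivity, by rw [div_le_one (by positivity)]; linarith⟩

/-- Effective times are never earlier than clocks, so a root clock among the first three of the raw
clocks is effective. The union bound gives `1/(d+1) + (d-2)/(d+1)`. -/
theorem real_lateTime_le_effTime (hd : 2 ≤ d) :
    (wordLaw d).real {ω | lateTime d ≤ effTime ω} ≤ ((d : ℝ) - 1) / (d + 1) := by
  set A := {ω : Clocks d | countBelow (fun a : Fin d => ω [a]) (ω []) < 3}
  have hA : MeasurableSet A := measurable_countBelow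
    (measurable_pi_lambda _ fun a => measurable_pi_apply [a]) (measurable_pi_apply [])
    measurableSet_Iio
  have hd1 : (0 : ℝ) < d + 1 := by positivity
  have h1 : 3 / ((d : ℝ) + 1) ≤ (wordLaw d).real A := by
    rw [div_le_iff₀ hd1, mul_comm]
    have h := ENNReal.toReal_mono (by finiteness) (three_le_mul_countBelow_lt hd)
    rw [ENNReal.toReal_mul, ENNReal.toReal_natCast] at h
    simpa [Measure.real] using h
  have h2 : (wordLaw d).real {ω | lateTime d ≤ ω []} = 1 - lateTime d := by
    have := (measurePreserving_eval_infinitePi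
      (fun _ : List (Fin d) => (volume : Measure unitInterval)) []).measure_preimage
      (measurableSet_Ici (a := lateTime d)).nullMeasurableSet
    rw [unitInterval.volume_Ici] at this
    rw [Measure.real, ← ENNReal.toReal_ofReal (sub_nonneg.2 (lateTime d).2.2), ← this]
    rfl
  have hsub : {ω : Clocks d | lateTime d ≤ effTime ω} ≤ᵐ[wordLaw d]
      ({ω | lateTime d ≤ ω []} ∪ Aᶜ : Set (Clocks d)) := by
    filter_upwards [ae_effTime_eq d] with ω hω hle
    by_contra hn
    have hn1 : ¬ lateTime d ≤ ω [] := fun h => hn (Or.inl h)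
    have hn2 : ω ∈ A := not_not.1 fun h => hn (Or.inr h)
    refine hn1 ?_
    rw [← hω.1 (lt_of_le_of_lt (countBelow_le_of_imp fun a ha => ?_) hn2)]
    · exact hle
    · exact (le_effTime (kid a ω)).trans_lt ha
  calc (wordLaw d).real {ω | lateTime d ≤ effTime ω}
      ≤ (wordLaw d).real ({ω | lateTime d ≤ ω []} ∪ Aᶜ) :=
        ENNReal.toReal_mono (measure_ne_top _ _) (measure_mono_ae hsub)
    _ ≤ (1 - lateTime d) + (1 - (wordLaw d).real A) := by
        refine (measureReal_union_le _ _).trans ?_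
        rw [h2, probReal_compl_eq_one_sub hA]
    _ ≤ (1 - (d : ℝ) / (d + 1)) + (1 - 3 / ((d : ℝ) + 1)) := by
        have : ((lateTime d : unitInterval) : ℝ) = (d : ℝ) / (d + 1) := rfl
        rw [this]; linarith
    _ = ((d : ℝ) - 1) / (d + 1) := by field_simp; ring

/-- The effective opening times of the edges above the root before time `d / (d + 1)` are `0` in number
with at most half the probability with which they are `2` in number. -/
theorem countBelow_eq_zero_le (hd : 2 ≤ d) :
    Measure.pi (fun _ : Fin d => wordLaw d)
        {η | countBelow (fun a => effTime (η a)) (lateTime d) = 0} ≤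
      2⁻¹ * Measure.pi (fun _ : Fin d => wordLaw d)
        {η | countBelow (fun a => effTime (η a)) (lateTime d) = 2} := by
  classical
  set t := lateTime d
  set π := Measure.pi fun _ : Fin d => wordLaw d
  set P : Set (Clocks d) := {ω | t ≤ effTime ω} with hP
  have hPm : MeasurableSet P := measurable_effTime measurableSet_Ici
  have hPc : Pᶜ = {ω | effTime ω < t} := by ext ω; simp [P]
  set p := wordLaw d P with hp
  set q := wordLaw d Pᶜ with hq
  have hF : ∀ T : Finset (Fin d), π {η | (Finset.univ.filter fun a => effTime (η a) < t) = T} =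
      q ^ T.card * p ^ (d - T.card) := fun T => by
    have : {η : Fin d → Clocks d | (Finset.univ.filter fun a => effTime (η a) < t) = T} =
        Set.univ.pi fun a => if a ∈ T then Pᶜ else P := by
      ext η
      simp only [Set.mem_ofPred_eq, Finset.ext_iff, Finset.mem_filter, Finset.mem_univ, true_and,
        Set.mem_univ_pi]
      refine forall_congr' fun a => ?_
      split_ifs with ha
      · simp [ha, hPc]
      · simp [ha, P]
    rw [this, Measure.pi_pi, ← Finset.prod_mul_prod_compl T,
      Finset.prod_congr rfl (g := fun _ => q) fun a ha => by rw [if_pos ha],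
      Finset.prod_congr rfl (s₁ := Tᶜ) (g := fun _ => p) fun a ha => by
        rw [if_neg (Finset.mem_compl.1 ha)],
      Finset.prod_const, Finset.prod_const, Finset.card_compl, Fintype.card_fin]
  have hm : Measurable fun η : Fin d → Clocks d =>
      (Finset.univ.filter fun a => effTime (η a) < t) := by
    refine measurable_to_countable' fun T => ?_
    have : (fun η : Fin d → Clocks d => (Finset.univ.filter fun a => effTime (η a) < t)) ⁻¹' {T} =
        ⋂ a, {η | effTime (η a) < t ↔ a ∈ T} := by
      ext η; simp [Finset.ext_iff]
    rw [this]
    refine MeasurableSet.iInter fun a => ?_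
    have hlt : MeasurableSet {η : Fin d → Clocks d | effTime (η a) < t} :=
      (measurable_effTime.comp (measurable_pi_apply a)) measurableSet_Iio
    by_cases ha : a ∈ T
    · simpa [ha] using hlt
    · have : {η : Fin d → Clocks d | effTime (η a) < t ↔ a ∈ T} = {η | effTime (η a) < t}ᶜ := by
        ext η; simp [ha]
      rw [this]
      exact hlt.compl
  have h0 : π {η | countBelow (fun a => effTime (η a)) t = 0} = p ^ d := by
    have := hF ∅
    simp only [Finset.card_empty, pow_zero, one_mul, Nat.sub_zero] at this
    rw [← this]
    simp only [countBelow, Finset.card_eq_zero]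
  have h2 : π {η | countBelow (fun a => effTime (η a)) t = 2} =
      d.choose 2 * (q ^ 2 * p ^ (d - 2)) := by
    have : {η : Fin d → Clocks d | countBelow (fun a => effTime (η a)) t = 2} =
        ⋃ T ∈ Finset.powersetCard 2 (Finset.univ : Finset (Fin d)),
          {η | (Finset.univ.filter fun a => effTime (η a) < t) = T} := by
      ext η; simp [countBelow]
    rw [this, measure_biUnion_finset]
    · rw [Finset.sum_congr rfl (g := fun _ => q ^ 2 * p ^ (d - 2)) fun T hT => by
        rw [hF, (Finset.mem_powersetCard.1 hT).2]]
      simp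
    · intro T _ T' _ hne
      exact Set.disjoint_left.2 fun η h h' => hne (Eq.trans (Eq.symm h) h')
    · exact fun T _ => hm (measurableSet_singleton T)
  -- Both counts are binomial; this is what remains after the common factor `p ^ (d - 2)`. With `p ≤
  -- (d-1)/(d+1)` and `q ≥ 2/(d+1)` it reduces to `(d-1)^2 ≤ d(d-1)`.
  have hpq : p ^ 2 ≤ 2⁻¹ * (d.choose 2 * q ^ 2) := by
    have hd' : (2 : ℝ) ≤ d := by exact_mod_cast hd
    have hpr : p.toReal ≤ ((d : ℝ) - 1) / (d + 1) := real_lateTime_le_effTime hd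
    have hqr : q.toReal = 1 - p.toReal := probReal_compl_eq_one_sub hPm
    have hq2 : 2 / ((d : ℝ) + 1) ≤ q.toReal := by
      rw [hqr]
      have : 1 - ((d : ℝ) - 1) / (d + 1) = 2 / (d + 1) := by field_simp; ring
      linarith
    rw [← ENNReal.toReal_le_toReal (by finiteness) (by finiteness)]
    simp only [ENNReal.toReal_mul, ENNReal.toReal_pow, ENNReal.toReal_inv, ENNReal.toReal_ofNat,
      ENNReal.toReal_natCast, Nat.cast_choose_two]
    calc p.toReal ^ 2 ≤ (((d : ℝ) - 1) / (d + 1)) ^ 2 :=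
          pow_le_pow_left₀ ENNReal.toReal_nonneg hpr 2
      _ ≤ 2⁻¹ * ((d : ℝ) * (d - 1) / 2 * (2 / ((d : ℝ) + 1)) ^ 2) := by
          rw [div_pow, div_pow, mul_div_assoc', mul_div_assoc']
          gcongr
          nlinarith
      _ ≤ _ := by
          have : (0 : ℝ) ≤ (d : ℝ) * (d - 1) / 2 :=
            div_nonneg (mul_nonneg (by linarith) (by linarith)) (by norm_num)
          gcongr
  rw [h0, h2]
  calc p ^ d = p ^ 2 * p ^ (d - 2) := by rw [← pow_add]; congr 1; omega
    _ ≤ 2⁻¹ * (d.choose 2 * q ^ 2) * p ^ (d - 2) := by gcongr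
    _ = _ := by ring

open Classical in
theorem min_le_card_opens {ι : Type*} [Fintype ι] (t : unitInterval) (x : ι → unitInterval) :
    min 2 (countBelow x t) ≤ (Finset.univ.filter fun a => Opens t x a).card := by
  refine (min_le_card_filter_card_lt (Finset.univ.filter fun a => x a < t) x 2).trans
    (Finset.card_le_card fun a ha => ?_)
  simp only [Finset.mem_filter, Finset.mem_univ, true_and] at ha ⊢
  refine ⟨ha.1, (Finset.card_le_card fun b hb => ?_).trans_lt ha.2⟩
  simp only [Finset.mem_filter, Finset.mem_univ, true_and] at hb ⊢
  exact ⟨hb.trans ha.1, hb⟩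

-- The product is at most `2^(-min(2, N_t))`. Against 1/2 this loses 1/2 when `N_t = 0`, breaks even
-- when `N_t = 1` and gains 1/4 when `N_t = 2`; the gain for larger `N_t` is discarded. As `s ≤ t`,
-- `N_t ≤ 2` forces `N_s < 3`, so the correction terms do not involve `s`. Gains stand on the left
-- to avoid subtraction in `ℝ≥0∞`.
open Classical in
theorem prod_opens_add_le {ι : Type*} [Fintype ι] {s t : unitInterval} (hst : s ≤ t)
    (x : ι → unitInterval) :
    Set.indicator {x : ι → unitInterval | countBelow x s < 3} 1 x *
        ∏ a, (if Opens t x a then (2⁻¹ : ℝ≥0∞) else 1) +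
      4⁻¹ * Set.indicator {x : ι → unitInterval | countBelow x t = 2} 1 x ≤
    2⁻¹ * Set.indicator {x : ι → unitInterval | countBelow x s < 3} 1 x +
      2⁻¹ * Set.indicator {x : ι → unitInterval | countBelow x t = 0} 1 x := by
  have hmono : countBelow x s ≤ countBelow x t :=
    countBelow_le_of_imp fun a ha => ha.trans_le hst
  have hprod : ∏ a, (if Opens t x a then (2⁻¹ : ℝ≥0∞) else 1) ≤ 2⁻¹ ^ min 2 (countBelow x t) := by
    rw [Finset.prod_ite, Finset.prod_const, Finset.prod_const_one, mul_one]
    exact pow_le_pow_right_of_le_one' (by simp) (min_le_card_opens t x)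
  have h14 : (2⁻¹ : ℝ≥0∞) ^ 2 = 4⁻¹ := by
    rw [← ENNReal.inv_pow]; norm_num
  have h42 : (4⁻¹ : ℝ≥0∞) + 4⁻¹ = 2⁻¹ := by
    rw [← h14, pow_two, ← mul_add, ENNReal.inv_two_add_inv_two, mul_one]
  by_cases hs : countBelow x s < 3
  · rcases Nat.lt_or_ge 2 (countBelow x t) with h | h
    · rw [min_eq_left h.le] at hprod
      have h2 : countBelow x t ≠ 2 := by omega
      have h0 : countBelow x t ≠ 0 := by omega
      simp only [Set.indicator, Set.mem_ofPred_eq, hs, h2, h0, if_true, if_false, Pi.one_apply,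
        one_mul, mul_zero, mul_one, add_zero]
      refine hprod.trans ?_
      rw [h14, ← h42]
      exact le_self_add
    · rw [min_eq_right h] at hprod
      obtain hm | hm | hm : countBelow x t = 0 ∨ countBelow x t = 1 ∨ countBelow x t = 2 := by
        omega
      all_goals
        rw [hm] at hprod
        simp only [Set.indicator, Set.mem_ofPred_eq, hs, hm, if_true, Pi.one_apply, one_mul,
          mul_one]
      · rw [ENNReal.inv_two_add_inv_two]
        simpa using hprod
      · simpa using hprod
      · rw [h14] at hprod
        rw [← h42]
        simpa [h42] using add_le_add_left hprod 4⁻¹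
  · have h2 : countBelow x t ≠ 2 := by omega
    simp [Set.indicator, hs, h2]

/-- Suppose that a tree whose root edge has an effective opening time in a given subset of `[0, t)`
fails to reach level `k` with conditional probability at most `1 / 2`. Then a tree whose root has
at most two effective openings before time `s ≤ t` fails to reach level `k + 1` with conditional
probability at most `1 / 2`. -/
theorem not_survives_kids_le {t : unitInterval} {k : ℕ}
    (h0 : Measure.pi (fun _ : Fin d => wordLaw d)
        {η | countBelow (fun a => effTime (η a)) t = 0} ≤
      2⁻¹ * Measure.pi (fun _ : Fin d => wordLaw d)
        {η | countBelow (fun a => effTime (η a)) t = 2})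
    (h : ∀ B, MeasurableSet B → B ⊆ Set.Iio t →
      wordLaw d (effTime ⁻¹' B ∩ {ω | ¬ Survives t k ω}) ≤ 2⁻¹ * wordLaw d (effTime ⁻¹' B))
    {s : unitInterval} (hst : s ≤ t) :
    Measure.pi (fun _ : Fin d => wordLaw d)
        {η | countBelow (fun a => effTime (η a)) s < 3 ∧
          ¬ ∃ a, Opens t (fun b => effTime (η b)) a ∧ Survives t k (η a)} ≤
      2⁻¹ * Measure.pi (fun _ : Fin d => wordLaw d)
        {η | countBelow (fun a => effTime (η a)) s < 3} := by
  classical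
  set π := Measure.pi fun _ : Fin d => wordLaw d
  have hX : Measurable fun (η : Fin d → Clocks d) b => effTime (η b) :=
    measurable_pi_lambda _ fun b => measurable_effTime.comp (measurable_pi_apply b)
  have hc : ∀ r : unitInterval, Measurable fun x : Fin d → unitInterval => countBelow x r :=
    fun r => measurable_countBelow measurable_id measurable_const
  have hI : ∀ (r : unitInterval) (M : Set ℕ),
      MeasurableSet {x : Fin d → unitInterval | countBelow x r ∈ M} := fun r M =>
    hc r (MeasurableSet.of_discrete (s := M))
  have hSm : MeasurableSet {ω : Clocks d | ¬ Survives t k ω} := (measurableSet_survives t k).compl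
  have hint : ∀ (r : unitInterval) (M : Set ℕ),
      ∫⁻ η, Set.indicator {x : Fin d → unitInterval | countBelow x r ∈ M} (1 : (Fin d → unitInterval) → ℝ≥0∞)
        (fun b => effTime (η b)) ∂π = π {η | countBelow (fun a => effTime (η a)) r ∈ M} :=
    fun r M => lintegral_indicator_one (hX (hI r M))
  have hmeas : ∀ (r : unitInterval) (M : Set ℕ), Measurable fun η : Fin d → Clocks d =>
      Set.indicator {x : Fin d → unitInterval | countBelow x r ∈ M} (1 : (Fin d → unitInterval) → ℝ≥0∞)
        (fun b => effTime (η b)) := fun r M => (measurable_one.indicator (hI r M)).comp hX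
  have hsel := lintegral_prod_selected_le (ι := Fin d) (wordLaw d) measurable_effTime hSm
    (measurableSet_Iio (a := t)) h (measurable_one.indicator (hI s (Set.Iio 3)))
    (O := fun a => {x | Opens t x a}) (measurableSet_opens t) (fun a x hx => hx.1)
  have hleft : π {η | countBelow (fun a => effTime (η a)) s < 3 ∧
      ¬ ∃ a, Opens t (fun b => effTime (η b)) a ∧ Survives t k (η a)} ≤
      ∫⁻ η, Set.indicator {x : Fin d → unitInterval | countBelow x s ∈ Set.Iio 3} 1
        (fun b => effTime (η b)) *
        ∏ a, (if (fun b => effTime (η b)) ∈ {x : Fin d → unitInterval | Opens t x a} then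
          Set.indicator {ω : Clocks d | ¬ Survives t k ω} 1 (η a) else 1) ∂π := by
    -- Markov's inequality at level `1`: on the failure event every selected child fails, so the
    -- integrand equals `1`.
    refine le_trans ?_ (mul_meas_ge_le_lintegral₀ ?_ 1)
    · rw [one_mul]
      refine measure_mono fun η hη => ?_
      rw [Set.mem_ofPred_eq]
      refine le_of_eq (Eq.symm ?_)
      have hmem : (fun b => effTime (η b)) ∈
          {x : Fin d → unitInterval | countBelow x s ∈ Set.Iio 3} := hη.1
      rw [Set.indicator_of_mem hmem, Pi.one_apply, one_mul]
      refine Finset.prod_eq_one fun a _ => ?_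
      split_ifs with ha
      · exact Set.indicator_of_mem (show ¬ Survives t k (η a) from fun h => hη.2 ⟨a, ha, h⟩) _
      · rfl
    · refine ((hmeas s (Set.Iio 3)).mul (Finset.measurable_prod _ fun a _ => ?_)).aemeasurable
      exact Measurable.ite (hX (measurableSet_opens t a))
        ((measurable_one.indicator hSm).comp (measurable_pi_apply a)) measurable_const
  refine hleft.trans (hsel.trans ?_)
  have hadd := lintegral_mono (μ := π) fun η : Fin d → Clocks d =>
    prod_opens_add_le hst fun b => effTime (η b)
  rw [lintegral_add_right, lintegral_add_right, lintegral_const_mul, lintegral_const_mul,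
    lintegral_const_mul] at hadd
  rotate_left
  · exact hmeas t {0}
  · exact hmeas s (Set.Iio 3)
  · exact hmeas t {2}
  · exact (hmeas t {0}).const_mul _
  · exact (hmeas t {2}).const_mul _
  have e1 := hint s (Set.Iio 3)
  have e2 := hint t {2}
  have e3 := hint t {0}
  simp only [Set.mem_Iio, Set.mem_singleton_iff] at e1 e2 e3
  rw [e1, e2, e3] at hadd
  -- By `h0` half the mass of `N_t = 0` is at most a quarter of the mass of `N_t = 2`; the latter
  -- term is finite and cancels.
  have hfin : 4⁻¹ * π {η | countBelow (fun a => effTime (η a)) t = 2} ≠ ∞ := by finiteness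
  refine (ENNReal.add_le_add_iff_right hfin).1 (hadd.trans ?_)
  refine add_le_add le_rfl ?_
  refine (mul_le_mul_right h0 _).trans (le_of_eq ?_)
  rw [← mul_assoc, ← ENNReal.mul_inv (by simp) (by simp)]
  norm_num

theorem measurableSet_kids_survive (t : unitInterval) (k : ℕ) :
    MeasurableSet {η : Fin d → Clocks d |
      ∃ a, Opens t (fun b => effTime (η b)) a ∧ Survives t k (η a)} := by
  simp only [Set.ofPred_exists]
  refine MeasurableSet.iUnion fun a => ?_
  have hX : Measurable fun (η : Fin d → Clocks d) b => effTime (η b) :=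
    measurable_pi_lambda _ fun b => measurable_effTime.comp (measurable_pi_apply b)
  exact (hX (measurableSet_opens t a)).inter (measurable_pi_apply a (measurableSet_survives t k))

/-- Conditionally on the effective opening time of the edge above the root, provided it is before
the time `d / (d + 1)`, level `k` is reached with probability at least `1 / 2`. -/
theorem effTime_mem_not_survives_le (hd : 2 ≤ d) (k : ℕ) {B : Set unitInterval}
    (hB : MeasurableSet B) (hBt : B ⊆ Set.Iio (lateTime d)) :
    wordLaw d (effTime ⁻¹' B ∩ {ω | ¬ Survives (lateTime d) k ω}) ≤
      2⁻¹ * wordLaw d (effTime ⁻¹' B) := by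
  induction k generalizing B with
  | zero => simp [Survives]
  | succ k ih =>
    set t := lateTime d
    set π := Measure.pi fun _ : Fin d => wordLaw d
    have hX : Measurable fun (p : unitInterval × (Fin d → Clocks d)) b => effTime (p.2 b) :=
      measurable_pi_lambda _ fun b =>
        measurable_effTime.comp ((measurable_pi_apply b).comp measurable_snd)
    let E : Set (unitInterval × (Fin d → Clocks d)) :=
      {p | p.1 ∈ B ∧ countBelow (fun a => effTime (p.2 a)) p.1 < 3}
    let N : Set (unitInterval × (Fin d → Clocks d)) :=
      {p | ¬ ∃ a, Opens t (fun b => effTime (p.2 b)) a ∧ Survives t k (p.2 a)}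
    have hE : MeasurableSet E := (measurable_fst hB).inter
      (measurable_countBelow hX measurable_fst measurableSet_Iio)
    have hN : MeasurableSet N := measurable_snd (measurableSet_kids_survive t k).compl
    -- The default value `1` of blocked edges lies outside `B`. Hence `effTime` lies in `B` exactly
    -- when the root clock does and fewer than three effective times above precede it.
    have h1 : 1 ∉ B := fun h => absurd (hBt h) (not_lt.2 unitInterval.le_one')
    have hae : (effTime ⁻¹' B : Set (Clocks d)) =ᵐ[wordLaw d]
        (fun ω => (ω [], fun a => kid a ω)) ⁻¹' E := by
      refine Filter.eventuallyEq_set.2 ?_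
      filter_upwards [ae_effTime_eq d] with ω hω
      by_cases hc : countBelow (fun a => effTime (kid a ω)) (ω []) < 3
      · simp [E, hω.1 hc, hc]
      · simp [E, hω.2 hc, hc, h1]
    have hae' : (effTime ⁻¹' B ∩ {ω | ¬ Survives t (k + 1) ω} : Set (Clocks d)) =ᵐ[wordLaw d]
        (fun ω => (ω [], fun a => kid a ω)) ⁻¹' (E ∩ N) := by
      rw [Set.preimage_inter]
      exact hae.inter (Filter.EventuallyEq.refl _ _)
    rw [measure_congr hae', measure_congr hae, ← Measure.map_apply measurable_root_kids hE,
      ← Measure.map_apply measurable_root_kids (hE.inter hN), map_wordLaw_root_kids,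
      Measure.prod_apply hE, Measure.prod_apply (hE.inter hN),
      ← lintegral_const_mul _ (measurable_measure_prodMk_left hE)]
    -- Fix the root clock `u`: the kids are independent of it, and the one-step bound applies with
    -- `s = u`.
    refine lintegral_mono fun u => ?_
    by_cases hu : u ∈ B
    · have := not_survives_kids_le (countBelow_eq_zero_le hd) (fun B hB hBt => ih hB hBt)
        (hBt hu).le
      simpa [E, N, hu, Set.preimage, Set.inter_def] using this
    · simp [E, hu, Set.preimage, Set.inter_def]

theorem not_survives_le (hd : 2 ≤ d) (k : ℕ) :
    wordLaw d {ω | ¬ Survives (lateTime d) k ω} ≤ 2⁻¹ := by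
  cases k with
  | zero => simp [Survives]
  | succ k =>
    -- No time precedes `0`, so `s = 0` makes the conditioning void; this reflects that the root has
    -- no edge below it.
    have h := not_survives_kids_le (countBelow_eq_zero_le hd)
      (fun B hB hBt => effTime_mem_not_survives_le hd k hB hBt) (s := 0) unitInterval.nonneg'
    have h0 : ∀ x : Fin d → unitInterval, countBelow x 0 < 3 := fun x => by
      simp [countBelow]
    simp only [h0, true_and, Set.ofPred_true, measure_univ, mul_one] at h
    refine le_trans (le_of_eq ?_) h
    have hmap : (wordLaw d).map (fun ω a => kid a ω) = Measure.pi fun _ : Fin d => wordLaw d := by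
      have := congrArg Measure.snd (map_wordLaw_root_kids d)
      rw [Measure.snd_prod, Measure.snd, Measure.map_map measurable_snd measurable_root_kids] at this
      exact this
    rw [← hmap]
    exact (Measure.map_apply (measurable_pi_lambda _ fun a => measurable_kid a)
      (measurableSet_kids_survive _ k).compl).symm

theorem not_forall_survives_le (hd : 2 ≤ d) :
    wordLaw d {ω | ¬ ∀ k, Survives (lateTime d) k ω} ≤ 2⁻¹ := by
  have : {ω : Clocks d | ¬ ∀ k, Survives (lateTime d) k ω} =
      ⋃ k, {ω | ¬ Survives (lateTime d) k ω} := by ext ω; simp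
  have hmono : Monotone fun k => {ω : Clocks d | ¬ Survives (lateTime d) k ω} :=
    monotone_nat_of_le_succ fun k ω hω h => hω (Survives.of_succ h)
  rw [this, hmono.measure_iUnion]
  exact iSup_le (not_survives_le hd)

theorem clockLaw_percolationEvent_ne_zero (hd : 2 ≤ d) :
    clockLaw (regularTree d)
      (percolationEvent (regularTree d) (fun _ => 3) [] (lateTime d)) ≠ 0 := by
  intro h0
  rw [← map_edgeClocks] at h0
  -- `Measure.le_map_apply` holds for arbitrary sets, so measurability of the percolation event is
  -- not needed.
  have h1 := le_antisymm
    ((Measure.le_map_apply measurable_edgeClocks.aemeasurable _).trans_eq h0) bot_le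
  have h2 : ∀ᵐ ω ∂(wordLaw d), ω ∈ {ω | ¬ ∀ k, Survives (lateTime d) k ω} := by
    filter_upwards [ae_noDescent d, measure_eq_zero_iff_ae_notMem.1 h1] with ω hω hn hs
    exact hn (hω.mem_percolationEvent hs)
  have h3 : wordLaw d Set.univ ≤ wordLaw d {ω | ¬ ∀ k, Survives (lateTime d) k ω} :=
    measure_mono_ae (h2.mono fun ω h _ => h)
  rw [measure_univ] at h3
  exact absurd (h3.trans (not_forall_survives_le hd)) (by norm_num)

theorem percolationEvent_mono {V : Type*} (G : SimpleGraph V) (κ : V → ℕ) (o : V) {s t : ℝ}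
    (hst : s ≤ t) : percolationEvent G κ o s ⊆ percolationEvent G κ o t := by
  refine fun U hU => Set.Infinite.mono (fun v hv => ?_) hU
  refine SimpleGraph.Reachable.mono (SimpleGraph.fromEdgeSet_mono ?_) hv
  rintro e ⟨he, ho⟩
  exact ⟨he, ho.1.trans_le hst, ho.2⟩

instance {V : Type*} (G : SimpleGraph V) : IsProbabilityMeasure (clockLaw G) := by
  unfold clockLaw; infer_instance

theorem criticalTime_regularTree_three_le (hd : 2 ≤ d) :
    criticalTime (regularTree d) (fun _ => 3) [] ≤ (d : ℝ) / (d + 1) := by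
  refine Real.sSup_le ?_ (by positivity)
  rintro s ⟨-, hs⟩
  by_contra hlt
  rw [theta, measureReal_eq_zero_iff] at hs
  -- Percolation is monotone in time, so `theta` cannot vanish at any time after `d / (d + 1)`.
  exact clockLaw_percolationEvent_ne_zero hd
    (measure_mono_null (percolationEvent_mono _ _ _ (not_le.1 hlt).le) hs)

end Survival

end ConstrainedDegree

theorem theorem5 (d : ℕ) (hd : 2 ≤ d) :
    ConstrainedDegree.criticalTime (ConstrainedDegree.regularTree d) (fun _ => 3) [] < 1 := by
  refine (ConstrainedDegree.criticalTime_regularTree_three_le hd).trans_lt ?_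
  rw [div_lt_one (by positivity)]
  exact lt_add_one _
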